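/- Let $X$ be a nonseparable Banach space over $\mathbb{R}$. A *hyperplane* of $X$ is a closed linear subspace of codimension one. Let $\mathcal{H}_\sigma(X)$ be the family of all subsets of $X$ that can be covered by countably many hyperplanes, and let $\mathfrak{cov}(X)$ be the least cardinality of a family of sets from $\mathcal{H}_\sigma(X)$ whose union is $X$. Suppose that at least one of the following holds: 1. $X$ admits a fundamental biorthogonal system, i.e. there are $x_i\in X$ and $x_i^*\in X^*$ ($i\in I$) with $x_i^*(x_j)=\delta_{i,j}$ for all $i,j\in I$ and with the linear span of $\{x_i : i\in I\}$ dense in $X$; 2. $X$ is of the form $C(K)$, the space of real continuous functions with the supremum norm on a compact Hausdorff space $K$ that is scattered (every nonempty subset of $K$ has a relatively isolated point); 3. $X$ contains an isomorphic copy of $\ell_1(\omega_1)$, i.e. some linear subspace of $X$ is linearly homeomorphic to $\ell_1(\omega_1)$; 4. the closed dual unit ball $B_{X^*}$ with the weak$^*$ topology has uncountable tightness, i.e. there are $A\subseteq B_{X^*}$ and $x^*\in\overline{A}$ such that $x^*\notin\overline{B}$ for every countable $B\subseteq A$ (closures in the weak$^*$ topology). Then $X$ is the union of a family of exactly $\omega_1$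 hyperplanes, and $\mathfrak{cov}(X)=\omega_1$. -/

import Mathlib

open scoped Cardinal Ordinal

universe u v

/-- A hyperplane of a Banach space `X`: a closed linear subspace of codimension one. -/
def IsHyperplane {X : Type u} [NormedAddCommGroup X] [NormedSpace ℝ X]
    (H : Submodule ℝ X) : Prop :=
  IsClosed (H : Set X) ∧ Module.finrank ℝ (X ⧸ H) = 1

/-- The hyperplane ideal of `X`: the family of all subsets of `X` that can be covered by
countably many hyperplanes of `X`. -/
def hyperplaneIdeal (X : Type u) [NormedAddCommGroup X] [NormedSpace ℝ X] : Set (Set X) :=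
  {Y | ∃ F : Set (Submodule ℝ X), F.Countable ∧ (∀ H ∈ F, IsHyperplane H) ∧
    Y ⊆ ⋃ H ∈ F, (H : Set X)}

/-- `cov(X)`: the minimal cardinality of a family of sets from the hyperplane ideal whose union
is all of `X`. -/
noncomputable def covNumber (X : Type u) [NormedAddCommGroup X] [NormedSpace ℝ X] :
    Cardinal.{u} :=
  sInf {κ | ∃ A : Set (Set X), A ⊆ hyperplaneIdeal X ∧ ⋃₀ A = Set.univ ∧ #A = κ}

/-- `X` admits a fundamental biorthogonal system `(x i, φ i)`: `φ i (x j) = δ i j` and the linear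
span of the `x i` is dense in `X`. The index set may be any type; since `x` is injective, nothing
is lost by taking it in the universe of `X`. -/
def HasFundamentalBiorthogonalSystem (X : Type u) [NormedAddCommGroup X] [NormedSpace ℝ X] :
    Prop :=
  ∃ (I : Type u) (x : I → X) (φ : I → StrongDual ℝ X),
    (∀ i, φ i (x i) = 1) ∧ (∀ i j, i ≠ j → φ i (x j) = 0) ∧
      (Submodule.span ℝ (Set.range x)).topologicalClosure = ⊤

/-- A topological space is scattered if every nonempty subset has a relatively isolated point. -/
def IsScatteredSpace (K : Type v) [TopologicalSpace K] : Prop :=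
  ∀ A : Set K, A.Nonempty → ∃ x ∈ A, ∃ U : Set K, IsOpen U ∧ U ∩ A = {x}

/-- `X` is (isometrically) the space `C(K)` of real continuous functions, with the supremum norm,
on some scattered compact Hausdorff space `K`. -/
def IsSpaceOfContinuousOnScattered (X : Type u) [NormedAddCommGroup X] [NormedSpace ℝ X] :
    Prop :=
  ∃ (K : Type v) (_ : TopologicalSpace K) (_ : CompactSpace K) (_ : T2Space K),
    IsScatteredSpace K ∧ Nonempty (X ≃ₗᵢ[ℝ] C(K, ℝ))

/-- `X` contains an isomorphic copy of `ℓ₁(ω₁)`: some linear subspace of `X` is linearly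
homeomorphic to `ℓ₁(ω₁)`. -/
def ContainsEllOneOmegaOne (X : Type u) [NormedAddCommGroup X] [NormedSpace ℝ X] : Prop :=
  ∃ Y : Submodule ℝ X, Nonempty (lp (fun _ : (ω₁ : Ordinal.{0}).ToType => ℝ) 1 ≃L[ℝ] Y)

/-- Countable tightness: a point in the closure of a set `A` is in the closure of a countable
subset of `A`. -/
def IsCountablyTight (K : Type v) [TopologicalSpace K] : Prop :=
  ∀ (A : Set K) (x : K), x ∈ closure A → ∃ B : Set K, B ⊆ A ∧ B.Countable ∧ x ∈ closure B

/-- The closed unit ball of the dual of `X`, as a subset of the dual with the weak* topology. -/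
def weakStarDualBall (X : Type u) [NormedAddCommGroup X] [NormedSpace ℝ X] :
    Set (WeakDual ℝ X) :=
  {f | ‖WeakDual.toStrongDual f‖ ≤ 1}

open Filter Topology Set

/-! It suffices to find ω₁ nonzero functionals such that every vector is killed by one of them
(`HasAnnihilatingFamily`). Their kernels cover the space, and by Baire no countable family from the
ideal does.

A fundamental biorthogonal system works because each vector meets only countably many of its
functionals. In `C(K)` with `K` scattered, every function has countable range, so it agrees at two
of any ω₁ points and differences of evaluations work. A copy of ℓ₁(ω₁) destroys countable tightness
of the dual ball, which leaves the last case.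

There one has z in the closure of an ω-closed set A but not in A. A recursion of length ω₁ yields an
ω-closed D and a nonempty compact P inside the closure of D and disjoint from D
(`OmegaClosed.exists_omegaOne_generated`). Take a maximal state on `C(P)` separating vectors in L²
(`SeparatedState`). If it separates uncountably many, X maps densely into a nonseparable Hilbert
space, whose orthonormal basis supplies the functionals. Otherwise countably many vectors have joint
fibers inside every neighbourhood of some p in P. Approximating countably many such fibers by points
of D gives a_i in D such that, for each x, a_i(x) = p(x) for some i; as p is not in D, the
functionals a_i - p are nonzero. -/

/-! ### Countable subsets of ω₁ -/

/-- The canonical well-ordered type of order type `ω₁`. -/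
abbrev OmegaOne : Type := (ω₁ : Ordinal.{0}).ToType

theorem mk_omegaOne : #OmegaOne = ℵ₁ := by
  simp [OmegaOne]

instance : Uncountable OmegaOne :=
  Cardinal.aleph0_lt_mk_iff.1 (mk_omegaOne ▸ Cardinal.aleph0_lt_aleph_one)

instance : Nonempty OmegaOne :=
  not_isEmpty_iff.1 fun _ => not_countable (α := OmegaOne) inferInstance

theorem countable_Iio_omegaOne (i : OmegaOne) : (Iio i).Countable := by
  rw [← Cardinal.le_aleph0_iff_set_countable, ← Cardinal.lt_aleph_one_iff]
  have h := Cardinal.card_typein_lt (α := OmegaOne) (r := LT.lt) i (by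
    rw [mk_omegaOne, Ordinal.type_toType, Cardinal.ord_aleph])
  rwa [Ordinal.card_typein, mk_omegaOne] at h

/-- Countable subsets of `ω₁` are strictly bounded. -/
theorem OmegaOne.exists_forall_lt {s : Set OmegaOne} (hs : s.Countable) :
    ∃ i, ∀ j ∈ s, j < i := by
  by_contra! h
  refine not_countable (α := OmegaOne) (countable_univ_iff.1 ?_)
  have hc : (⋃ j ∈ s, Iic j).Countable := hs.biUnion fun j _ => by
    rw [← Iio_insert]
    exact (countable_Iio_omegaOne j).insert j
  refine hc.mono fun i _ => ?_
  obtain ⟨j, hj, hij⟩ := h i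
  exact mem_biUnion hj hij

theorem OmegaOne.exists_forall_lt_range {β : Type*} [Countable β] (f : β → OmegaOne) :
    ∃ i, ∀ b, f b < i :=
  (OmegaOne.exists_forall_lt (countable_range f)).imp fun _ h b => h _ (mem_range_self b)

theorem exists_embedding_omegaOne (I : Type*) [Uncountable I] : Nonempty (OmegaOne ↪ I) := by
  rw [← Cardinal.lift_mk_le', mk_omegaOne]
  simp

theorem exists_surjective_omegaOne {J : Type} [Nonempty J] (hJ : #J ≤ ℵ₁) :
    ∃ f : OmegaOne → J, Function.Surjective f := by
  rw [← mk_omegaOne] at hJ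
  obtain ⟨e⟩ := hJ
  exact ⟨Function.invFun e, Function.invFun_surjective e.injective⟩

/-! ### Annihilating families and coverings by hyperplanes -/

section

variable (X : Type u) [NormedAddCommGroup X] [NormedSpace ℝ X]

/-- There are `ω₁` nonzero functionals such that every vector is annihilated by one of them. -/
def HasAnnihilatingFamily : Prop :=
  ∃ φ : OmegaOne → StrongDual ℝ X, (∀ i, φ i ≠ 0) ∧ ∀ x, ∃ i, φ i x = 0

variable {X}

theorem IsHyperplane.ne_top {H : Submodule ℝ X} (h : IsHyperplane H) : H ≠ ⊤ := by
  rintro rfl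
  have := h.2
  rw [Module.finrank_zero_of_subsingleton] at this
  exact zero_ne_one this

theorem isHyperplane_ker {φ : StrongDual ℝ X} (h : φ ≠ 0) :
    IsHyperplane (LinearMap.ker (φ : X →ₗ[ℝ] ℝ)) := by
  refine ⟨φ.isClosed_ker, ?_⟩
  have hs : Function.Surjective (φ : X →ₗ[ℝ] ℝ) :=
    LinearMap.surjective fun h0 => h (ContinuousLinearMap.coe_injective h0)
  rw [((φ : X →ₗ[ℝ] ℝ).quotKerEquivOfSurjective hs).finrank_eq, Module.finrank_self]

/-- Baire category: a proper subspace has empty interior. -/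
theorem univ_notMem_hyperplaneIdeal [CompleteSpace X] :
    (univ : Set X) ∉ hyperplaneIdeal X := by
  rintro ⟨F, hF, hH, hU⟩
  have := hF.to_subtype
  obtain ⟨H, hi⟩ := nonempty_interior_of_iUnion_of_closed
    (f := fun H : F => (H.1 : Set X)) (fun H => (hH H.1 H.2).1) (by
      rw [← univ_subset_iff, ← biUnion_eq_iUnion F (fun H _ => (H : Set X))]; exact hU)
  exact (hH H.1 H.2).ne_top (H.1.eq_top_of_nonempty_interior' hi)

theorem sUnion_mem_hyperplaneIdeal {A : Set (Set X)} (hA : A ⊆ hyperplaneIdeal X)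
    (hc : A.Countable) : ⋃₀ A ∈ hyperplaneIdeal X := by
  choose! F hF hH hU using fun a (ha : a ∈ A) => hA ha
  refine ⟨⋃ a ∈ A, F a, hc.biUnion hF, ?_, ?_⟩
  · simp only [mem_iUnion]
    rintro H ⟨a, ha, h⟩
    exact hH a ha H h
  · refine sUnion_subset fun a ha x hx => ?_
    obtain ⟨H, h, hxH⟩ := mem_iUnion₂.1 (hU a ha hx)
    exact mem_biUnion (mem_biUnion ha h) hxH

theorem aleph_one_le_of_cover [CompleteSpace X] {A : Set (Set X)} (hA : A ⊆ hyperplaneIdeal X)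
    (hU : ⋃₀ A = univ) : ℵ₁ ≤ #A := by
  rw [Cardinal.aleph_one_le_iff, ← not_le, Cardinal.le_aleph0_iff_set_countable]
  intro hc
  have := sUnion_mem_hyperplaneIdeal hA hc
  rw [hU] at this
  exact univ_notMem_hyperplaneIdeal this

theorem IsHyperplane.mem_hyperplaneIdeal {H : Submodule ℝ X} (h : IsHyperplane H) :
    (H : Set X) ∈ hyperplaneIdeal X :=
  ⟨{H}, countable_singleton H, by simpa using h, by simp⟩

theorem HasAnnihilatingFamily.covering [CompleteSpace X] (h : HasAnnihilatingFamily X) :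
    (∃ F : Set (Submodule ℝ X), (∀ H ∈ F, IsHyperplane H) ∧ #F = ℵ₁ ∧
      ⋃ H ∈ F, (H : Set X) = Set.univ) ∧
    covNumber X = ℵ₁ := by
  obtain ⟨φ, h0, hφ⟩ := h
  let F : Set (Submodule ℝ X) := range fun i => LinearMap.ker (φ i : X →ₗ[ℝ] ℝ)
  have hH : ∀ H ∈ F, IsHyperplane H := by
    rintro _ ⟨i, rfl⟩
    exact isHyperplane_ker (h0 i)
  have hU : ⋃ H ∈ F, (H : Set X) = univ := by
    refine eq_univ_of_forall fun x => ?_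
    obtain ⟨i, hi⟩ := hφ x
    exact mem_biUnion (mem_range_self i) hi
  have hle : #F ≤ ℵ₁ := by
    have := Cardinal.mk_range_le_lift (f := fun i => LinearMap.ker (φ i : X →ₗ[ℝ] ℝ))
    rw [mk_omegaOne] at this
    simpa using this
  let A : Set (Set X) := (fun H : Submodule ℝ X => (H : Set X)) '' F
  have hA : A ⊆ hyperplaneIdeal X := by
    rintro _ ⟨H, hF, rfl⟩
    exact (hH H hF).mem_hyperplaneIdeal
  have hAU : ⋃₀ A = univ := by rw [sUnion_image]; exact hU
  have hAF : #A = #F := Cardinal.mk_image_eq SetLike.coe_injective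
  -- Different functionals may share a kernel, so the lower bound comes from Baire and not from the
  -- indexing.
  have hF : #F = ℵ₁ := le_antisymm hle (hAF ▸ aleph_one_le_of_cover hA hAU)
  refine ⟨⟨F, hH, hF, hU⟩, le_antisymm (csInf_le' ⟨A, hA, hAU, hAF.trans hF⟩) ?_⟩
  refine le_csInf ⟨_, A, hA, hAU, rfl⟩ ?_
  rintro _ ⟨B, hB, hBU, rfl⟩
  exact aleph_one_le_of_cover hB hBU

/-! ### Countable supports and biorthogonal systems -/

theorem HasAnnihilatingFamily.of_countable_support {I : Type*} [Uncountable I]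
    (φ : I → StrongDual ℝ X) (h0 : ∀ i, φ i ≠ 0) (hc : ∀ x, {i | φ i x ≠ 0}.Countable) :
    HasAnnihilatingFamily X := by
  obtain ⟨e⟩ := exists_embedding_omegaOne I
  refine ⟨fun i => φ (e i), fun i => h0 _, fun x => ?_⟩
  by_contra! h
  refine not_countable (α := OmegaOne) (countable_univ_iff.1 ?_)
  exact ((hc x).preimage e.injective).mono fun i _ => h i

/-- Vectors in the span have countable support, and the support of a limit of a sequence lies in the
union of the supports. Nonseparability makes the index set uncountable. -/
theorem HasAnnihilatingFamily.of_fundamentalBiorthogonalSystem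
    (hX : ¬ TopologicalSpace.SeparableSpace X) (h : HasFundamentalBiorthogonalSystem X) :
    HasAnnihilatingFamily X := by
  obtain ⟨I, x, φ, h1, h0, hd⟩ := h
  have hI : Uncountable I := by
    refine not_countable_iff.1 fun hI => hX ?_
    rw [← TopologicalSpace.isSeparable_univ_iff]
    have := (countable_range x).isSeparable.span (R := ℝ).closure
    rwa [← Submodule.topologicalClosure_coe, hd] at this
  refine .of_countable_support φ (fun i h => by simpa [h] using h1 i) fun y => ?_
  have hy : y ∈ closure (Submodule.span ℝ (range x) : Set X) := by
    rw [← Submodule.topologicalClosure_coe, hd]; trivial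
  obtain ⟨s, hs, hlim⟩ := mem_closure_iff_seq_limit.1 hy
  have hfin : ∀ z ∈ Submodule.span ℝ (range x), {i | φ i z ≠ 0}.Countable := fun z hz => by
    induction hz using Submodule.span_induction with
    | mem z hz =>
      obtain ⟨j, rfl⟩ := hz
      refine (countable_singleton j).mono fun i hi => ?_
      by_contra hij
      exact hi (h0 i j hij)
    | zero => simp
    | add a b _ _ ha hb =>
      refine (ha.union hb).mono fun i hi => ?_
      by_contra hij
      simp only [mem_union, mem_ofPred_eq, not_or, not_not] at hij
      exact hi (by rw [map_add, hij.1, hij.2, add_zero])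
    | smul c a _ ha =>
      refine ha.mono fun i hi => ?_
      by_contra hij
      simp only [mem_ofPred_eq, not_not] at hij
      exact hi (by rw [map_smul, hij, smul_zero])
  refine (countable_iUnion fun n => hfin _ (hs n)).mono fun i hi => ?_
  by_contra hij
  simp only [mem_iUnion, not_exists, mem_ofPred_eq, not_not] at hij
  refine hi (tendsto_nhds_unique (((φ i).continuous.tendsto y).comp hlim) ?_)
  simp [Function.comp_def, hij]

end

/-! ### Continuous functions on scattered compact spaces -/

section Scattered

variable {K : Type v} [TopologicalSpace K] [CompactSpace K] [T2Space K]

/-- Let W be the union of the open sets with countable image. A relatively isolated point x of its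
complement has a compact neighbourhood V with V \ {x} inside W. The part of V where f differs from
f(x) is a countable union of compact subsets of W, so V has countable image and x lies in W after
all. -/
theorem IsScatteredSpace.countable_range (hK : IsScatteredSpace K) (f : C(K, ℝ)) :
    (range f).Countable := by
  let W : Set K := ⋃₀ {U | IsOpen U ∧ (f '' U).Countable}
  have hWo : IsOpen W := isOpen_sUnion fun U hU => hU.1
  have hcomp : ∀ C ⊆ W, IsCompact C → (f '' C).Countable := by
    intro C hCW hC
    obtain ⟨T, hT, hTf, hCT⟩ := hC.elim_finite_subcover_image
      (b := {U : Set K | IsOpen U ∧ (f '' U).Countable}) (c := id) (fun U hU => hU.1)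
      (by simpa only [id, ← sUnion_eq_biUnion] using hCW)
    refine (Countable.mono (image_mono hCT) ?_)
    rw [image_iUnion₂]
    exact hTf.countable.biUnion fun U hU => (hT hU).2
  suffices h : W = univ by
    rw [← image_univ]
    exact hcomp univ h.ge isCompact_univ
  by_contra hne
  obtain ⟨x, hx, U, hU, hUx⟩ := hK Wᶜ (by rwa [nonempty_compl])
  have hxU : x ∈ U := (hUx.symm ▸ mem_singleton x : x ∈ U ∩ Wᶜ).1
  obtain ⟨V, hV, hVU, hVc⟩ := local_compact_nhds (hU.mem_nhds hxU)
  have hVW : ∀ y ∈ V, y ≠ x → y ∈ W := fun y hy hyx => by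
    by_contra hyW
    exact hyx (hUx ▸ (⟨hVU hy, hyW⟩ : y ∈ U ∩ Wᶜ) : y ∈ ({x} : Set K))
  have hcV : (f '' V).Countable := by
    have : f '' V ⊆ insert (f x) (⋃ n : ℕ, f '' (V ∩ {y | 1 / ((n : ℝ) + 1) ≤ |f y - f x|})) := by
      rintro _ ⟨y, hy, rfl⟩
      by_cases hyx : f y = f x
      · exact .inl hyx
      · obtain ⟨n, hn⟩ := exists_nat_one_div_lt (abs_pos.2 (sub_ne_zero.2 hyx))
        exact .inr (mem_iUnion.2 ⟨n, y, ⟨hy, hn.le⟩, rfl⟩)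
    refine Countable.mono this ((countable_iUnion fun n => hcomp _ ?_ ?_).insert _)
    · rintro y ⟨hy, hyn⟩
      refine hVW y hy ?_
      rintro rfl
      have : (0 : ℝ) < 1 / ((n : ℝ) + 1) := by positivity
      simp only [mem_ofPred_eq, sub_self, abs_zero] at hyn
      linarith
    · exact hVc.inter_right (isClosed_le continuous_const (by fun_prop))
  refine hx (mem_sUnion.2 ⟨interior V, ⟨isOpen_interior, ?_⟩, mem_interior_iff_mem_nhds.2 hV⟩)
  exact hcV.mono (image_mono interior_subset)

/-- Countably many functions separate the points and embed `K` in a countable power of ℝ. Thus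
nonseparability of `C(K)` forces `K` to be uncountable. -/
theorem secondCountableTopology_of_countable_compact [Countable K] :
    SecondCountableTopology K := by
  have hsep : ∀ p : {p : K × K // p.1 ≠ p.2}, ∃ f : C(K, ℝ), f p.1.1 ≠ f p.1.2 := fun p => by
    obtain ⟨f, h0, h1, -⟩ := exists_continuous_zero_one_of_isClosed
      (isClosed_singleton (x := p.1.1)) (isClosed_singleton (x := p.1.2)) (by simpa using p.2)
    refine ⟨f, ?_⟩
    rw [h0 rfl, h1 rfl]
    simp
  choose f hf using hsep
  let g : K → ({p : K × K // p.1 ≠ p.2} → ℝ) := fun x p => f p x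
  have hg : Continuous g := by fun_prop
  have hinj : Function.Injective g := fun x y hxy => by
    by_contra hne
    exact hf ⟨(x, y), hne⟩ (congrFun hxy ⟨(x, y), hne⟩)
  exact (hg.isClosedEmbedding hinj).isEmbedding.secondCountableTopology

theorem HasAnnihilatingFamily.of_continuousOnScattered {X : Type u} [NormedAddCommGroup X]
    [NormedSpace ℝ X] (hX : ¬ TopologicalSpace.SeparableSpace X)
    (h : IsSpaceOfContinuousOnScattered.{u, v} X) : HasAnnihilatingFamily X := by
  obtain ⟨K, _, _, _, hK, ⟨T⟩⟩ := h
  have hunc : Uncountable K := by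
    refine not_countable_iff.1 fun _ => hX ?_
    have := secondCountableTopology_of_countable_compact (K := K)
    exact T.toHomeomorph.symm.surjective.denseRange.separableSpace T.toHomeomorph.symm.continuous
  obtain ⟨e⟩ := exists_embedding_omegaOne K
  let J := {p : OmegaOne × OmegaOne // p.1 ≠ p.2}
  have hJ : Nonempty J := by
    obtain ⟨i, j, hij⟩ := exists_pair_ne OmegaOne
    exact ⟨⟨(i, j), hij⟩⟩
  obtain ⟨s, hs⟩ := exists_surjective_omegaOne (J := J) (by
    refine (Cardinal.mk_subtype_le _).trans ?_
    rw [Cardinal.mk_prod, Cardinal.lift_id, mk_omegaOne,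
      Cardinal.mul_eq_self (Cardinal.aleph0_le_aleph 1)])
  let δ : K → StrongDual ℝ X := fun k =>
    (ContinuousMap.evalCLM ℝ k).comp (T.toContinuousLinearEquiv : X →L[ℝ] C(K, ℝ))
  have hδ : ∀ k x, δ k x = T x k := fun _ _ => rfl
  refine ⟨fun i => δ (e (s i).1.1) - δ (e (s i).1.2), fun i h => ?_, fun x => ?_⟩
  · obtain ⟨f, h0, h1, -⟩ := exists_continuous_zero_one_of_isClosed
      (isClosed_singleton (x := e (s i).1.1)) (isClosed_singleton (x := e (s i).1.2))
      (by simpa using (s i).2)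
    have := DFunLike.congr_fun h (T.symm f)
    simp [hδ, h0 rfl, h1 rfl] at this
  · by_contra! h
    refine not_countable (α := OmegaOne) ?_
    have hinj : Function.Injective fun i => (⟨T x (e i), mem_range_self _⟩ : range (T x)) := by
      intro i j hij
      by_contra hne
      obtain ⟨k, hk⟩ := hs ⟨(i, j), hne⟩
      refine h k ?_
      simpa [hk, hδ, sub_eq_zero] using hij
    have := (hK.countable_range (T x)).to_subtype
    exact hinj.countable

end Scattered

/-! ### Maps into nonseparable Hilbert spaces -/

/-- The Hilbert space obtained from a positive semidefinite form by separation and completion. -/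
theorem PreInnerProductSpace.Core.exists_hilbert {V : Type u} [AddCommGroup V] [Module ℝ V]
    (c : PreInnerProductSpace.Core ℝ V) :
    ∃ (H : Type u) (_ : NormedAddCommGroup H) (_ : InnerProductSpace ℝ H) (_ : CompleteSpace H)
      (T : V →ₗ[ℝ] H), (∀ x y, inner ℝ (T x) (T y) = c.inner x y) ∧ DenseRange T := by
  let _ : SeminormedAddCommGroup V := InnerProductSpace.Core.toSeminormedAddCommGroup (𝕜 := ℝ) (c := c)
  let _ : InnerProductSpace ℝ V := InnerProductSpace.ofCore c
  refine ⟨UniformSpace.Completion V, inferInstance, inferInstance, inferInstance,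
    (UniformSpace.Completion.toComplₗᵢ : V →ₗᵢ[ℝ] UniformSpace.Completion V).toLinearMap,
    fun x y => ?_, UniformSpace.Completion.denseRange_coe⟩
  exact UniformSpace.Completion.inner_coe x y

section

variable {X : Type u} [NormedAddCommGroup X] [NormedSpace ℝ X]

/-- Each vector has only countably many nonzero coordinates in an orthonormal basis; dense range
keeps the pulled-back coordinates nonzero. -/
theorem HasAnnihilatingFamily.of_hilbert {H : Type*} [NormedAddCommGroup H]
    [InnerProductSpace ℝ H] [CompleteSpace H] (T : X →L[ℝ] H) (hT : DenseRange T)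
    (hH : ¬ TopologicalSpace.SeparableSpace H) : HasAnnihilatingFamily X := by
  obtain ⟨w, b, hb⟩ := exists_hilbertBasis ℝ H
  have hw : Uncountable w := by
    refine not_countable_iff.1 fun hw => hH ?_
    rw [← TopologicalSpace.isSeparable_univ_iff]
    have := (countable_range b).isSeparable.span (R := ℝ).closure
    rwa [← Submodule.topologicalClosure_coe, b.dense_span] at this
  refine .of_countable_support (fun i => (innerSL ℝ (b i)).comp T) (fun i h => ?_) fun x => ?_
  · have h2 : (innerSL ℝ (b i) : H → ℝ) = fun _ => 0 := by
      refine hT.equalizer (innerSL ℝ (b i)).continuous continuous_const ?_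
      funext x
      exact DFunLike.congr_fun h x
    have h3 : inner ℝ (b i) (b i) = (0 : ℝ) := congrFun h2 (b i)
    have h4 := b.orthonormal.1 i
    rw [inner_self_eq_zero.1 h3, norm_zero] at h4
    exact zero_ne_one h4
  · have hs := (b.orthonormal.inner_products_summable (x := T x)).countable_support
    refine hs.mono fun i hi => ?_
    simpa [Function.mem_support] using hi

/-- In the Hilbert space of `B`, the vectors of one weight n are √(1/(n+1))-separated, so
separability would make each of the countably many weight classes countable. -/
theorem HasAnnihilatingFamily.of_bilinForm (B : X →ₗ[ℝ] X →ₗ[ℝ] ℝ)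
    (hsymm : ∀ x y, B x y = B y x) (hpos : ∀ x, 0 ≤ B x x) (hbd : ∀ x, B x x ≤ ‖x‖ ^ 2)
    {E : Set (X × ℕ)} (hE : ¬ E.Countable)
    (hsep : ∀ a ∈ E, ∀ b ∈ E, a ≠ b →
      min (1 / ((a.2 : ℝ) + 1)) (1 / ((b.2 : ℝ) + 1)) ≤ B (a.1 - b.1) (a.1 - b.1)) :
    HasAnnihilatingFamily X := by
  let c : PreInnerProductSpace.Core ℝ X :=
    { inner := fun x y => B x y
      conj_inner_symm := fun x y => by simp [hsymm x y]
      re_inner_nonneg := fun x => by simpa using hpos x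
      add_left := fun x y z => by simp
      smul_left := fun x y r => by simp }
  obtain ⟨H, _, _, _, T, hT, hd⟩ := c.exists_hilbert
  have hTn : ∀ x, ‖T x‖ ^ 2 = B x x := fun x => by
    rw [← real_inner_self_eq_norm_sq, hT]; rfl
  let S : X →L[ℝ] H := T.mkContinuous 1 fun x => by
    rw [one_mul]
    refine le_of_sq_le_sq ?_ (norm_nonneg x)
    exact (hTn x).trans_le (hbd x)
  refine .of_hilbert S hd fun hsepH => hE ?_
  have hn : ∀ n : ℕ, (E ∩ {a | a.2 = n}).Countable := by
    intro n
    let r : ℝ := √(1 / ((n : ℝ) + 1))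
    have hr : 0 < r := Real.sqrt_pos.2 (by positivity)
    refine PairwiseDisjoint.countable_of_isOpen (s := fun a : X × ℕ => Metric.ball (T a.1) (r / 2))
      ?_ (fun _ _ => Metric.isOpen_ball) fun a _ => ⟨T a.1, Metric.mem_ball_self (half_pos hr)⟩
    rintro a ⟨ha, han⟩ b ⟨hb, hbn⟩ hab
    refine Metric.ball_disjoint_ball ?_
    rw [add_halves, dist_eq_norm, ← map_sub]
    refine Real.sqrt_le_iff.2 ⟨norm_nonneg _, ?_⟩
    have := hsep a ha b hb hab
    rw [mem_ofPred_eq] at han hbn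
    rwa [han, hbn, min_self, ← hTn] at this
  refine (countable_iUnion hn).mono fun a ha => ?_
  exact mem_iUnion.2 ⟨a.2, ha, rfl⟩

end

/-! ### States on `C(P, ℝ)` and their extensions -/

/-- A normalized positive linear functional on `C(P, ℝ)`. -/
structure IsState {P : Type u} [TopologicalSpace P] (m : C(P, ℝ) →ₗ[ℝ] ℝ) : Prop where
  nonneg : ∀ f, 0 ≤ f → 0 ≤ m f
  map_one : m 1 = 1

namespace IsState

variable {P : Type u} [TopologicalSpace P] {m m₀ m₁ : C(P, ℝ) →ₗ[ℝ] ℝ}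

theorem mono (hm : IsState m) {f g : C(P, ℝ)} (h : f ≤ g) : m f ≤ m g := by
  have := hm.nonneg (g - f) (sub_nonneg.2 h)
  rwa [map_sub, sub_nonneg] at this

/-- The variance of `f` under `m` is nonnegative. -/
theorem sq_le (hm : IsState m) (f : C(P, ℝ)) : m f ^ 2 ≤ m (f * f) := by
  have h : 0 ≤ m ((f - m f • 1) * (f - m f • 1)) :=
    hm.nonneg _ fun p => mul_self_nonneg ((f - m f • (1 : C(P, ℝ))) p)
  have e : (f - m f • 1) * (f - m f • 1) = f * f - (2 * m f) • f + (m f ^ 2) • 1 := by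
    ext p
    simp
    ring
  rw [e, map_add, map_sub, map_smul, map_smul, hm.map_one, smul_eq_mul, smul_eq_mul] at h
  linarith

theorem abs_le_norm [CompactSpace P] (hm : IsState m) (f : C(P, ℝ)) : |m f| ≤ ‖f‖ := by
  have h : ∀ g : C(P, ℝ), m g ≤ ‖g‖ := fun g => by
    have := hm.mono (f := g) (g := ‖g‖ • 1) fun p => by simpa using g.apply_le_norm p
    rwa [map_smul, hm.map_one, smul_eq_mul, mul_one] at this
  refine abs_le'.2 ⟨h f, ?_⟩
  rw [← map_neg, ← norm_neg]
  exact h (-f)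

theorem average (h₀ : IsState m₀) (h₁ : IsState m₁) :
    IsState ((1 / 2 : ℝ) • (m₀ + m₁)) where
  nonneg f hf := by
    have := h₀.nonneg f hf
    have := h₁.nonneg f hf
    simp only [LinearMap.smul_apply, LinearMap.add_apply, smul_eq_mul]
    positivity
  map_one := by
    simp only [LinearMap.smul_apply, LinearMap.add_apply, smul_eq_mul, h₀.map_one, h₁.map_one]
    norm_num

theorem eval (p : P) :
    IsState (ContinuousMap.evalCLM ℝ p : C(P, ℝ) →L[ℝ] ℝ).toLinearMap where
  nonneg _ hf := hf p
  map_one := rfl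

/-- The limit of states along an ultrafilter. -/
theorem exists_limit [CompactSpace P] {I : Type*} (𝓥 : Ultrafilter I)
    (M : I → C(P, ℝ) →ₗ[ℝ] ℝ) (hM : ∀ i, IsState (M i)) :
    ∃ m, IsState m ∧ ∀ f, Tendsto (fun i => M i f) 𝓥 (𝓝 (m f)) := by
  have hlim : ∀ f, ∃ c : ℝ, Tendsto (fun i => M i f) 𝓥 (𝓝 c) := fun f => by
    obtain ⟨c, -, hc⟩ := (isCompact_Icc (a := -‖f‖) (b := ‖f‖)).ultrafilter_le_nhds
      (𝓥.map fun i => M i f) (by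
        rw [Ultrafilter.coe_map, le_principal_iff]
        exact eventually_map.2 (Eventually.of_forall fun i => abs_le.1 ((hM i).abs_le_norm f)))
    exact ⟨c, hc⟩
  choose L hL using hlim
  refine ⟨{ toFun := L, map_add' := fun f g => ?_, map_smul' := fun c f => ?_ },
    ⟨fun f hf => ?_, ?_⟩, hL⟩
  · refine tendsto_nhds_unique (hL _) ?_
    simpa only [map_add] using (hL f).add (hL g)
  · refine tendsto_nhds_unique (hL _) ?_
    simpa only [map_smul, RingHom.id_apply] using (hL f).const_smul c
  · exact ge_of_tendsto (hL f) (Eventually.of_forall fun i => (hM i).nonneg f hf)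
  · refine tendsto_nhds_unique (hL 1) ?_
    simp only [fun i => (hM i).map_one]
    exact tendsto_const_nhds

/-- Riesz extension after prescribing the value `t` at `f`. The bounds `hup` and `hlo` give
positivity on C + ℝf for negative and positive coefficients of `f`; the constants in `C` dominate
every function. -/
theorem exists_extension [CompactSpace P] (hm : IsState m) {C : Submodule ℝ C(P, ℝ)}
    (hC : 1 ∈ C) {f : C(P, ℝ)} (hf : f ∉ C) {t : ℝ} (hup : ∀ h ∈ C, f ≤ h → t ≤ m h)
    (hlo : ∀ h ∈ C, h ≤ f → m h ≤ t) :
    ∃ m', IsState m' ∧ (∀ h ∈ C, m' h = m h) ∧ m' f = t := by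
  let F₀ : C(P, ℝ) →ₗ.[ℝ] ℝ := ⟨C, m.comp C.subtype⟩
  let F := F₀.supSpanSingleton f t hf
  have hFd : F.domain = C ⊔ Submodule.span ℝ {f} := LinearPMap.domain_supSpanSingleton _ _ _ _
  have hFv : ∀ (h : C(P, ℝ)) (hh : h ∈ C) (c : ℝ) (hd : h + c • f ∈ F.domain),
      F ⟨h + c • f, hd⟩ = m h + c * t := fun h hh c hd => by
    exact LinearPMap.supSpanSingleton_apply_mk F₀ f t hf h hh c
  let s : PointedCone ℝ C(P, ℝ) :=
    { carrier := {g | 0 ≤ g}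
      add_mem' := fun {a b} ha hb => add_nonneg (a := a) (b := b) ha hb
      zero_mem' := le_refl (0 : C(P, ℝ))
      smul_mem' := fun c g hg p => mul_nonneg c.2 (hg p) }
  have hs : ∀ g, g ∈ s ↔ 0 ≤ g := fun g => Iff.rfl
  obtain ⟨g, hgF, hgs⟩ := riesz_extension s F (by
      rintro ⟨x, hx⟩ hxs
      have hx' := hx
      rw [hFd, Submodule.mem_sup] at hx'
      obtain ⟨h, hh, z, hz, rfl⟩ := hx'
      obtain ⟨c, rfl⟩ := Submodule.mem_span_singleton.1 hz
      rw [hFv h hh c hx]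
      have hpos : ∀ p, 0 ≤ h p + c * f p := fun p => by simpa using (hs _).1 hxs p
      rcases lt_trichotomy c 0 with hc | rfl | hc
      · have := hup ((-c)⁻¹ • h) (C.smul_mem _ hh) fun p => by
          have h0 : 0 < -c := neg_pos.2 hc
          change f p ≤ (-c)⁻¹ * h p
          rw [inv_mul_eq_div, le_div_iff₀ h0]
          linarith [hpos p]
        rw [map_smul, smul_eq_mul, inv_mul_eq_div, le_div_iff₀ (neg_pos.2 hc)] at this
        linarith
      · rw [zero_mul, add_zero]
        exact hm.nonneg h fun p => by simpa using hpos p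
      · have := hlo (-(c⁻¹ • h)) (C.neg_mem (C.smul_mem _ hh)) fun p => by
          change -(c⁻¹ * h p) ≤ f p
          have e : (h p + c * f p) / c = c⁻¹ * h p + f p := by field_simp
          have := div_nonneg (hpos p) hc.le
          linarith
        rw [map_neg, map_smul, smul_eq_mul, inv_mul_eq_div, neg_le, le_div_iff₀ hc] at this
        linarith)
    (by
      intro y
      have h1 : ‖y‖ • (1 : C(P, ℝ)) ∈ F.domain := by
        rw [hFd]
        exact Submodule.mem_sup_left (C.smul_mem _ hC)
      refine ⟨⟨_, h1⟩, fun p => ?_⟩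
      have := y.neg_norm_le_apply p
      change 0 ≤ ‖y‖ * 1 + y p
      linarith)
  have hgC : ∀ h ∈ C, g h = m h := fun h hh => by
    have hd : h + (0 : ℝ) • f ∈ F.domain := by
      rw [hFd, zero_smul, add_zero]; exact Submodule.mem_sup_left hh
    have := (hgF ⟨_, hd⟩).trans (hFv h hh 0 hd)
    simpa using this
  refine ⟨g, ⟨fun f hf => hgs f hf, (hgC 1 hC).trans hm.map_one⟩, hgC, ?_⟩
  have hd : (0 : C(P, ℝ)) + (1 : ℝ) • f ∈ F.domain := by
    rw [hFd, zero_add, one_smul]; exact Submodule.mem_sup_right (Submodule.mem_span_singleton_self f)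
  have := (hgF ⟨_, hd⟩).trans (hFv 0 C.zero_mem 1 hd)
  simpa using this

/-- If the restriction of `m` to `C` does not determine the value at `f` up to `δ`, then it has an
extension under which `f` is at `L²`-distance at least `δ / 2` from all of `C`. -/
theorem exists_extension_sq_dist [CompactSpace P] (hm : IsState m) {C : Submodule ℝ C(P, ℝ)}
    (hC : 1 ∈ C) {f : C(P, ℝ)} {δ : ℝ} (hδ : 0 < δ)
    (hgap : ∀ h ∈ C, ∀ h' ∈ C, f ≤ h → h' ≤ f → δ ≤ m h - m h') :
    f ∉ C ∧ ∃ m', IsState m' ∧ (∀ h ∈ C, m' h = m h) ∧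
      ∀ h ∈ C, δ ^ 2 / 4 ≤ m' ((f - h) * (f - h)) := by
  have hf : f ∉ C := fun hf => by
    have := hgap f hf f hf le_rfl le_rfl
    linarith
  -- Both inf U and sup L are admissible values at `f` and differ by at least δ; the average of the
  -- two extensions is the required state.
  let U := m '' {h | h ∈ C ∧ f ≤ h}
  let L := m '' {h | h ∈ C ∧ h ≤ f}
  have hUne : U.Nonempty := ⟨_, ‖f‖ • 1, ⟨C.smul_mem _ hC, fun p => by
    simpa using f.apply_le_norm p⟩, rfl⟩
  have hLne : L.Nonempty := ⟨_, (-‖f‖) • 1, ⟨C.smul_mem _ hC, fun p => by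
    simpa using f.neg_norm_le_apply p⟩, rfl⟩
  have hUL : ∀ a ∈ U, ∀ b ∈ L, δ ≤ a - b := by
    rintro _ ⟨h, ⟨hh, hfh⟩, rfl⟩ _ ⟨h', ⟨hh', hfh'⟩, rfl⟩
    exact hgap h hh h' hh' hfh hfh'
  have hUbdd : BddBelow U := by
    obtain ⟨b, hb⟩ := hLne
    exact ⟨b, fun a ha => by linarith [hUL a ha b hb]⟩
  have hLbdd : BddAbove L := by
    obtain ⟨a, ha⟩ := hUne
    exact ⟨a, fun b hb => by linarith [hUL a ha b hb]⟩
  have hsub : δ ≤ sInf U - sSup L := by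
    have : sSup L ≤ sInf U - δ := by
      refine csSup_le hLne fun b hb => ?_
      have : b + δ ≤ sInf U := le_csInf hUne fun a ha => by linarith [hUL a ha b hb]
      linarith
    linarith
  obtain ⟨m₁, hm₁, hC₁, hf₁⟩ := hm.exists_extension hC hf (t := sInf U)
    (fun h hh hfh => csInf_le hUbdd ⟨h, ⟨hh, hfh⟩, rfl⟩)
    (fun h hh hfh => le_csInf hUne fun a ha => by
      linarith [hUL a ha (m h) ⟨h, ⟨hh, hfh⟩, rfl⟩])
  obtain ⟨m₀, hm₀, hC₀, hf₀⟩ := hm.exists_extension hC hf (t := sSup L)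
    (fun h hh hfh => csSup_le hLne fun b hb => by
      linarith [hUL (m h) ⟨h, ⟨hh, hfh⟩, rfl⟩ b hb])
    (fun h hh hfh => le_csSup hLbdd ⟨h, ⟨hh, hfh⟩, rfl⟩)
  refine ⟨hf, _, hm₀.average hm₁, fun h hh => ?_, fun h hh => ?_⟩
  · simp only [LinearMap.smul_apply, LinearMap.add_apply, smul_eq_mul, hC₀ h hh, hC₁ h hh]
    ring
  · have h₀ := hm₀.sq_le (f - h)
    have h₁ := hm₁.sq_le (f - h)
    rw [map_sub, hf₀, hC₀ h hh] at h₀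
    rw [map_sub, hf₁, hC₁ h hh] at h₁
    simp only [LinearMap.smul_apply, LinearMap.add_apply, smul_eq_mul]
    -- With a = inf U - m h and b = sup L - m h, (a² + b²)/2 ≥ (a - b)²/4 ≥ δ²/4.
    nlinarith [sq_nonneg ((sInf U - m h) + (sSup L - m h))]

end IsState

/-! ### Maximal separated states -/

section

variable {X : Type u} [NormedAddCommGroup X] [NormedSpace ℝ X]
  {P : Type v} [TopologicalSpace P]

/-- The continuous functions on `P` which are constant on the joint fibers of the functions `Θ x`,
`x ∈ S`. -/
def fiberFunctions (Θ : X →ₗ[ℝ] C(P, ℝ)) (S : Set X) : Submodule ℝ C(P, ℝ) where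
  carrier := {h | ∀ p q, (∀ x ∈ S, Θ x p = Θ x q) → h p = h q}
  add_mem' := fun {a b} ha hb p q hpq => by
    change a p + b p = a q + b q
    rw [ha p q hpq, hb p q hpq]
  zero_mem' := fun _ _ _ => rfl
  smul_mem' := fun c a ha p q hpq => by
    change c * a p = c * a q
    rw [ha p q hpq]

variable {Θ : X →ₗ[ℝ] C(P, ℝ)} {S S' : Set X}

theorem fiberFunctions_mono (hS : S ⊆ S') : fiberFunctions Θ S ≤ fiberFunctions Θ S' :=
  fun _ hh p q hpq => hh p q fun x hx => hpq x (hS hx)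

theorem one_mem_fiberFunctions : 1 ∈ fiberFunctions Θ S := fun _ _ _ => rfl

theorem apply_mem_fiberFunctions {x : X} (hx : x ∈ S) : Θ x ∈ fiberFunctions Θ S :=
  fun _ _ h => h x hx

theorem mul_mem_fiberFunctions {f g : C(P, ℝ)} (hf : f ∈ fiberFunctions Θ S)
    (hg : g ∈ fiberFunctions Θ S) : f * g ∈ fiberFunctions Θ S := fun p q hpq => by
  change f p * g p = f q * g q
  rw [hf p q hpq, hg p q hpq]

variable (Θ) in
/-- A state on `C(P, ℝ)` together with a set of vectors with weights, such that the `L²`-distance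
between different vectors is bounded below in terms of the weights. -/
structure SeparatedState where
  carrier : Set (X × ℕ)
  state : C(P, ℝ) →ₗ[ℝ] ℝ
  isState : IsState state
  separated : ∀ a ∈ carrier, ∀ b ∈ carrier, a ≠ b →
    min (1 / ((a.2 : ℝ) + 1)) (1 / ((b.2 : ℝ) + 1)) ≤ state (Θ (a.1 - b.1) * Θ (a.1 - b.1))

namespace SeparatedState

/-- The functions measurable with respect to the vectors of a separated state. -/
def functions (s : SeparatedState Θ) : Submodule ℝ C(P, ℝ) :=
  fiberFunctions Θ (Prod.fst '' s.carrier)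

/-- Agreement is required only on functions of the old vectors. These form an algebra containing the
squares in `separated`, so old distances persist while the state stays free elsewhere. -/
instance : Preorder (SeparatedState Θ) where
  le s t := s.carrier ⊆ t.carrier ∧ ∀ h ∈ s.functions, t.state h = s.state h
  le_refl _ := ⟨Subset.rfl, fun _ _ => rfl⟩
  le_trans s t r hst htr := ⟨hst.1.trans htr.1, fun h hh =>
    (htr.2 h (fiberFunctions_mono (image_mono hst.1) hh)).trans (hst.2 h hh)⟩

theorem sq_sub_mem_functions {s : SeparatedState Θ} {a b : X × ℕ} (ha : a ∈ s.carrier)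
    (hb : b ∈ s.carrier) : Θ (a.1 - b.1) * Θ (a.1 - b.1) ∈ s.functions := by
  have h : Θ (a.1 - b.1) ∈ s.functions := by
    rw [map_sub]
    exact Submodule.sub_mem _ (apply_mem_fiberFunctions (mem_image_of_mem _ ha))
      (apply_mem_fiberFunctions (mem_image_of_mem _ hb))
  exact mul_mem_fiberFunctions h h

/-- A chain is bounded by the union of carriers with an ultrafilter limit of the states, which are
eventually constant on the functions of each member. -/
theorem exists_isMax [CompactSpace P] [Nonempty P] : ∃ s : SeparatedState Θ, IsMax s := by
  refine zorn_le fun c hc => ?_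
  rcases c.eq_empty_or_nonempty with rfl | hne
  · exact ⟨⟨∅, _, .eval (Classical.arbitrary P), by simp⟩, by simp [upperBounds]⟩
  have : Nonempty c := hne.to_subtype
  have : IsDirectedOrder c := directedOn_iff_isDirectedOrder.1 hc.directedOn
  let 𝓥 : Ultrafilter c := Ultrafilter.of atTop
  have hV : ∀ s : c, ∀ᶠ t in (𝓥 : Filter c), s ≤ t := fun s =>
    Ultrafilter.of_le _ (eventually_ge_atTop s)
  obtain ⟨m, hm, hlim⟩ := IsState.exists_limit 𝓥 (fun s : c => s.1.state) fun s => s.1.isState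
  have hms : ∀ s : c, ∀ h ∈ s.1.functions, m h = s.1.state h := fun s h hh => by
    refine tendsto_nhds_unique (hlim h) (tendsto_const_nhds.congr' ?_)
    filter_upwards [hV s] with t hst
    exact (hst.2 h hh).symm
  refine ⟨⟨⋃ s : c, s.1.carrier, m, hm, fun a ha b hb hab => ?_⟩, fun s hs => ⟨?_, ?_⟩⟩
  · obtain ⟨s, hs⟩ := mem_iUnion.1 ha
    obtain ⟨t, ht⟩ := mem_iUnion.1 hb
    obtain ⟨r, hsr, htr⟩ := exists_ge_ge s t
    rw [hms r _ (sq_sub_mem_functions (hsr.1 hs) (htr.1 ht))]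
    exact r.1.separated a (hsr.1 hs) b (htr.1 ht) hab
  · exact subset_iUnion (fun s : c => s.1.carrier) ⟨s, hs⟩
  · exact hms ⟨s, hs⟩

/-- For a maximal separated state, every `Θ x` can be squeezed between functions measurable with
respect to the state. -/
theorem exists_squeeze [CompactSpace P] {s : SeparatedState Θ} (hs : IsMax s) (x : X) {δ : ℝ}
    (hδ : 0 < δ) : ∃ h ∈ s.functions, ∃ h' ∈ s.functions, Θ x ≤ h ∧ h' ≤ Θ x ∧
      s.state h - s.state h' < δ := by
  by_contra! hgap
  obtain ⟨hx, m, hm, hms, hdist⟩ := s.isState.exists_extension_sq_dist (C := s.functions)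
    one_mem_fiberFunctions hδ (f := Θ x) fun h hh h' hh' => hgap h hh h' hh'
  -- The weight n records the distance of the new vector from the old ones, so that `(x, n)` can be
  -- adjoined.
  obtain ⟨n, hn⟩ := exists_nat_one_div_lt (show (0 : ℝ) < δ ^ 2 / 4 by positivity)
  have hdist' : ∀ a ∈ s.carrier, 1 / ((n : ℝ) + 1) ≤ m (Θ (x - a.1) * Θ (x - a.1)) :=
    fun a ha => by
      rw [map_sub]
      exact hn.le.trans (hdist _ (apply_mem_fiberFunctions (mem_image_of_mem _ ha)))
  let t : SeparatedState Θ :=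
    { carrier := insert (x, n) s.carrier
      state := m
      isState := hm
      separated := by
        rintro a (rfl | ha) b (rfl | hb) hab
        · exact absurd rfl hab
        · exact (min_le_left _ _).trans (hdist' b hb)
        · refine (min_le_right _ _).trans ((hdist' a ha).trans_eq ?_)
          rw [← neg_sub a.1, map_neg, neg_mul_neg]
        · rw [hms _ (sq_sub_mem_functions ha hb)]
          exact s.separated a ha b hb hab }
  have hst : s ≤ t := ⟨subset_insert _ _, hms⟩
  -- Maximality puts `(x, n)` in the old carrier, so `Θ x` would be one of its functions, which the
  -- gap excludes.
  exact hx (apply_mem_fiberFunctions ⟨(x, n), (hs hst).1 (mem_insert _ _), rfl⟩)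

theorem hasAnnihilatingFamily [CompactSpace P] {s : SeparatedState Θ}
    (hΘ : ∀ x, ‖Θ x‖ ≤ ‖x‖) (hs : ¬ s.carrier.Countable) : HasAnnihilatingFamily X := by
  let B : X →ₗ[ℝ] X →ₗ[ℝ] ℝ := LinearMap.mk₂ ℝ (fun x y => s.state (Θ x * Θ y))
    (fun x y z => by simp [add_mul]) (fun c x y => by simp)
    (fun x y z => by simp [mul_add]) (fun c x y => by simp)
  refine .of_bilinForm B (fun x y => ?_) (fun x => ?_) (fun x => ?_) hs s.separated
  · exact congrArg s.state (mul_comm _ _)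
  · exact s.isState.nonneg _ fun p => mul_self_nonneg (Θ x p)
  · refine (le_abs_self _).trans ((s.isState.abs_le_norm _).trans ((norm_mul_le _ _).trans ?_))
    rw [sq]
    exact mul_self_le_mul_self (norm_nonneg _) (hΘ x)

end SeparatedState

/-! ### The dichotomy: Hilbert image or small fibers -/

/-- Let `P` be a compact space whose topology is induced by the functions `Θ x`. Then either `X` has
an annihilating family or some point of `P` has arbitrarily small neighbourhoods containing joint
fibers of countably many of the functions `Θ x`. -/
theorem hasAnnihilatingFamily_or_exists_fiber_subset [CompactSpace P] [Nonempty P]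
    (hΘ : ∀ x, ‖Θ x‖ ≤ ‖x‖) (hind : IsInducing fun (p : P) (x : X) => Θ x p) :
    HasAnnihilatingFamily X ∨ ∃ E : Set X, E.Countable ∧ ∃ p : P, ∀ U ∈ 𝓝 p, ∃ q,
      {r | ∀ x ∈ E, Θ x r = Θ x q} ⊆ U := by
  obtain ⟨s, hs⟩ := SeparatedState.exists_isMax (Θ := Θ)
  by_cases hc : s.carrier.Countable
  swap
  · exact .inl (SeparatedState.hasAnnihilatingFamily hΘ hc)
  refine .inr ⟨Prod.fst '' s.carrier, hc.image _, ?_⟩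
  by_contra! hno
  choose U hU hUq using hno
  -- The factor 2 leaves room to replace the centre p by any q within ε of it.
  have hbasis : ∀ p, ∃ (T : Finset X) (ε : ℝ), 0 < ε ∧
      {r | ∀ x ∈ T, |Θ x r - Θ x p| < 2 * ε} ⊆ U p := fun p => by
    have h := hU p
    rw [hind.nhds_eq_comap, mem_comap] at h
    obtain ⟨V, hV, hVU⟩ := h
    rw [nhds_pi, Filter.mem_pi] at hV
    obtain ⟨I, hI, t, ht, htV⟩ := hV
    choose e he het using fun x => Metric.mem_nhds_iff.1 (ht x)
    obtain ⟨ε, hε, hεe⟩ : ∃ ε : ℝ, 0 < ε ∧ ∀ x ∈ I, 2 * ε ≤ e x := by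
      rcases I.eq_empty_or_nonempty with rfl | hne
      · exact ⟨1, one_pos, by simp⟩
      · obtain ⟨x₀, hx₀, hmin⟩ := exists_min_image I e hI hne
        refine ⟨e x₀ / 2, half_pos (he x₀), fun x hx => ?_⟩
        linarith [hmin x hx]
    refine ⟨hI.toFinset, ε, hε, fun r hr => hVU (htV fun x hx => het x ?_)⟩
    rw [Metric.mem_ball, Real.dist_eq]
    exact (hr x (hI.mem_toFinset.2 hx)).trans_le (hεe x hx)
  choose T ε hε hTU using hbasis
  obtain ⟨F, hF⟩ := isCompact_univ.elim_nhds_subcover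
    (fun p => {r | ∀ x ∈ T p, |Θ x r - Θ x p| < ε p}) fun p _ => by
      have : IsOpen {r | ∀ x ∈ T p, |Θ x r - Θ x p| < ε p} := by
        have e : {r | ∀ x ∈ T p, |Θ x r - Θ x p| < ε p} =
            ⋂ x ∈ T p, {r | |Θ x r - Θ x p| < ε p} := by
          ext r; simp
        rw [e]
        exact isOpen_biInter_finset fun x _ => isOpen_lt (by fun_prop) continuous_const
      exact this.mem_nhds fun x _ => by simpa using hε p
  have hFne : F.Nonempty := by
    obtain ⟨p, hp, -⟩ := mem_iUnion₂.1 (hF.2 (mem_univ (Classical.arbitrary P)))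
    exact ⟨p, hp⟩
  obtain ⟨p₀, hp₀, hmin⟩ := F.exists_min_image ε hFne
  classical
  let R : Finset X := F.biUnion T
  -- By compactness, every joint fiber carries an oscillation of at least one fixed ε of some vector
  -- from one finite set `R`.
  have hosc : ∀ q, ∃ r, (∀ x ∈ Prod.fst '' s.carrier, Θ x r = Θ x q) ∧
      ∃ x ∈ R, ε p₀ ≤ |Θ x r - Θ x q| := fun q => by
    obtain ⟨p, hp, hq⟩ := mem_iUnion₂.1 (hF.2 (mem_univ q))
    obtain ⟨r, hr, hrU⟩ := not_subset.1 (hUq p q)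
    have : ∃ x ∈ T p, 2 * ε p ≤ |Θ x r - Θ x p| := by
      by_contra! h
      exact hrU (hTU p h)
    obtain ⟨x, hx, hxr⟩ := this
    refine ⟨r, hr, x, Finset.mem_biUnion.2 ⟨p, hp, hx⟩, ?_⟩
    have h1 := abs_sub_le (Θ x r) (Θ x q) (Θ x p)
    have h2 : |Θ x q - Θ x p| < ε p := hq x hx
    have h3 := hmin p hp
    linarith
  have hδ : 0 < ε p₀ / (R.card + 1) := div_pos (hε p₀) (by positivity)
  choose h hh h' hh' hle hle' hlt using fun x => SeparatedState.exists_squeeze hs x hδ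
  -- The squeezing functions are constant on the fiber of q, so for the oscillating vector their gap
  -- at q is at least ε. Integrating the sum of gaps contradicts the choice of δ.
  have hsum : ε p₀ • (1 : C(P, ℝ)) ≤ ∑ x ∈ R, (h x - h' x) := fun q => by
    obtain ⟨r, hr, x, hx, hxr⟩ := hosc q
    change ε p₀ * 1 ≤ (∑ x ∈ R, (h x - h' x)) q
    rw [mul_one, ContinuousMap.coe_sum, Finset.sum_apply]
    have hxle : ε p₀ ≤ (h x - h' x) q := by
      have e1 : h x r = h x q := hh x r q hr
      have e2 : h' x r = h' x q := hh' x r q hr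
      have a1 : Θ x r ≤ h x r := hle x r
      have a2 : Θ x q ≤ h x q := hle x q
      have a3 : h' x r ≤ Θ x r := hle' x r
      have a4 : h' x q ≤ Θ x q := hle' x q
      change ε p₀ ≤ h x q - h' x q
      rcases abs_cases (Θ x r - Θ x q) with h0 | h0 <;> linarith
    refine hxle.trans (Finset.single_le_sum (f := fun x => (h x - h' x) q) (fun y _ => ?_) hx)
    exact sub_nonneg.2 ((hle' y q).trans (hle y q))
  have h1 := s.isState.mono hsum
  rw [map_smul, s.isState.map_one, map_sum, smul_eq_mul, mul_one] at h1
  have h2 : ∑ x ∈ R, s.state (h x - h' x) ≤ R.card * (ε p₀ / (R.card + 1)) := by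
    rw [← nsmul_eq_mul]
    refine Finset.sum_le_card_nsmul _ _ _ fun x _ => ?_
    rw [map_sub]
    exact (hlt x).le
  have h3 : R.card * (ε p₀ / (R.card + 1)) < ε p₀ := by
    rw [mul_div_assoc', div_lt_iff₀ (by positivity)]
    nlinarith [hε p₀]
  linarith

end

/-! ### ω-closed sets and sequences of length ω₁ -/

/-- A recursive construction of length `ω₁`. -/
theorem exists_omegaOne_seq {Y : Type*} (R : Set Y → Y → Prop)
    (h : ∀ C : Set Y, C.Countable → ∃ y, R C y) :
    ∃ f : OmegaOne → Y, ∀ i, R (f '' Iio i) (f i) := by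
  have hc : ∀ (i : OmegaOne) (g : ∀ j, j < i → Y),
      (range fun j : Iio i => g j j.2).Countable := fun i g => by
    have := (countable_Iio_omegaOne i).to_subtype
    exact countable_range _
  let F : ∀ i : OmegaOne, (∀ j, j < i → Y) → Y := fun i g => (h _ (hc i g)).choose
  refine ⟨wellFounded_lt.fix F, fun i => ?_⟩
  have hF := (h _ (hc i fun j _ => wellFounded_lt.fix F j)).choose_spec
  rw [wellFounded_lt.fix_eq F i, image_eq_range]
  exact hF

/-- A set containing the closure of each of its countable subsets. -/
def OmegaClosed {K : Type*} [TopologicalSpace K] (A : Set K) : Prop :=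
  ∀ C ⊆ A, C.Countable → closure C ⊆ A

section

variable {X : Type u} [NormedAddCommGroup X] [NormedSpace ℝ X]
  {K : Type v} [TopologicalSpace K] [CompactSpace K] {Θ : X →ₗ[ℝ] C(K, ℝ)} {A : Set K}

/-- Restricted to `E`, values lie in a metrizable space, so a sequence from `A` approximates those
of `p`. Its closure is compact and stays in `A`, hence contains a point attaining them. -/
theorem OmegaClosed.exists_eq_on (hA : OmegaClosed A) {p : K} (hp : p ∈ closure A) {E : Set X}
    (hE : E.Countable) : ∃ a ∈ A, ∀ x ∈ E, Θ x a = Θ x p := by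
  have := hE.to_subtype
  let π : K → E → ℝ := fun r x => Θ x r
  have hπ : Continuous π := by fun_prop
  obtain ⟨y, hy, hlim⟩ := mem_closure_iff_seq_limit.1
    (image_closure_subset_closure_image hπ (mem_image_of_mem π hp))
  choose a ha hay using hy
  have h1 : π p ∈ closure (π '' range a) := mem_closure_of_tendsto hlim
    (Eventually.of_forall fun n => ⟨a n, mem_range_self n, hay n⟩)
  have h2 : closure (π '' range a) ⊆ π '' closure (range a) :=
    closure_minimal (image_mono subset_closure) (isClosed_closure.isCompact.image hπ).isClosed
  obtain ⟨r, hr, hrp⟩ := h2 h1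
  exact ⟨r, hA _ (range_subset_iff.2 ha) (countable_range a) hr, fun x hx => congrFun hrp ⟨x, hx⟩⟩

theorem IsClosed.exists_finite_separating (hsep : ∀ p q : K, (∀ x, Θ x p = Θ x q) → p = q)
    {C : Set K} (hC : IsClosed C) {z : K} (hz : z ∉ C) :
    ∃ S : Set X, S.Finite ∧ ∀ q ∈ C, ∃ x ∈ S, Θ x q ≠ Θ x z := by
  obtain ⟨S, hS⟩ := hC.isCompact.elim_finite_subcover (fun x : X => {q | Θ x q ≠ Θ x z})
    (fun x => isOpen_ne_fun (by fun_prop) continuous_const) fun q hq => by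
      by_contra h
      simp only [mem_iUnion, mem_ofPred_eq, not_exists, not_not] at h
      exact hz (hsep q z h ▸ hq)
  refine ⟨S, S.finite_toSet, fun q hq => ?_⟩
  obtain ⟨x, hx, h⟩ := mem_iUnion₂.1 (hS hq)
  exact ⟨x, hx, h⟩

theorem OmegaClosed.exists_free_seq (hsep : ∀ p q : K, (∀ x, Θ x p = Θ x q) → p = q)
    (hA : OmegaClosed A) {z : K} (hz : z ∈ closure A) (hzA : z ∉ A) :
    ∃ (a : OmegaOne → K) (T : OmegaOne → Set X), (∀ i, (T i).Countable) ∧ Monotone T ∧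
      (∀ i, ∀ x ∈ T i, Θ x (a i) = Θ x z) ∧
      ∀ i, ∀ q ∈ closure (a '' Iio i), ∃ x ∈ T i, Θ x q ≠ Θ x z := by
  let Y := A × {T : Set X // T.Countable}
  obtain ⟨f, hf⟩ := exists_omegaOne_seq (Y := Y)
    (fun C y => (∀ c ∈ C, c.2.1 ⊆ y.2.1) ∧ (∀ x ∈ y.2.1, Θ x y.1 = Θ x z) ∧
      ∀ q ∈ closure ((fun c : Y => (c.1 : K)) '' C), ∃ x ∈ y.2.1, Θ x q ≠ Θ x z) fun C hC => by
    have hCA : closure ((fun c : Y => (c.1 : K)) '' C) ⊆ A :=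
      hA _ (by rintro _ ⟨c, -, rfl⟩; exact c.1.2) (hC.image _)
    obtain ⟨S, hS, hSz⟩ := isClosed_closure.exists_finite_separating hsep fun h => hzA (hCA h)
    have hT : (S ∪ ⋃ c ∈ C, c.2.1).Countable := hS.countable.union (hC.biUnion fun c _ => c.2.2)
    obtain ⟨a, ha, haz⟩ := hA.exists_eq_on (Θ := Θ) hz hT
    refine ⟨(⟨a, ha⟩, ⟨_, hT⟩), fun c hc => ?_, haz, fun q hq => ?_⟩
    · exact (subset_biUnion_of_mem (u := fun c : Y => c.2.1) hc).trans subset_union_right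
    · obtain ⟨x, hx, h⟩ := hSz q hq
      exact ⟨x, .inl hx, h⟩
  refine ⟨fun i => (f i).1, fun i => (f i).2.1, fun i => (f i).2.2, fun i j hij => ?_,
    fun i => (hf i).2.1, fun i q hq => (hf i).2.2 q (by rwa [image_image])⟩
  rcases hij.eq_or_lt with rfl | hij
  · exact Subset.rfl
  · exact (hf j).1 _ (mem_image_of_mem f hij)

/-- `D` is the union of the closures of initial segments of a free sequence. A countable subset
lives in one stage, whence ω-closedness; a limit of the whole sequence agrees with `z` on every `T
i`, while `T i` separates `z` from stage i. -/
theorem OmegaClosed.exists_omegaOne_generated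
    (hsep : ∀ p q : K, (∀ x, Θ x p = Θ x q) → p = q)
    (hA : OmegaClosed A) {z : K} (hz : z ∈ closure A) (hzA : z ∉ A) :
    ∃ (D : Set K) (T : OmegaOne → Set X), OmegaClosed D ∧ (∀ i, (T i).Countable) ∧ Monotone T ∧
      (∃ q ∈ closure D, ∀ i, ∀ x ∈ T i, Θ x q = Θ x z) ∧
      ∀ q ∈ D, ∃ i, ∃ x ∈ T i, Θ x q ≠ Θ x z := by
  obtain ⟨a, T, hTc, hT, haT, haz⟩ := hA.exists_free_seq hsep hz hzA
  have hmono : Monotone fun i => closure (a '' Iio i) :=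
    fun i j hij => closure_mono (image_mono (Iio_subset_Iio hij))
  refine ⟨⋃ i, closure (a '' Iio i), T, fun C hCA hC => ?_, hTc, hT, ?_, fun q hq => ?_⟩
  · choose! k hk using fun c (hc : c ∈ C) => mem_iUnion.1 (hCA hc)
    obtain ⟨i, hi⟩ := OmegaOne.exists_forall_lt (hC.image k)
    refine (closure_minimal (fun c hc => ?_) isClosed_closure).trans
      (subset_iUnion (fun i => closure (a '' Iio i)) i)
    exact hmono (hi _ (mem_image_of_mem k hc)).le (hk c hc)
  · let 𝓥 : Ultrafilter OmegaOne := Ultrafilter.of atTop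
    have hV : ∀ i, ∀ᶠ j in (𝓥 : Filter OmegaOne), i ≤ j := fun i =>
      Ultrafilter.of_le _ (eventually_ge_atTop i)
    have hlim : Tendsto a 𝓥 (𝓝 (𝓥.map a).lim) := (𝓥.map a).le_nhds_lim
    refine ⟨_, mem_closure_of_tendsto hlim (Eventually.of_forall fun j => ?_), fun i x hx => ?_⟩
    · obtain ⟨i, hi⟩ := OmegaOne.exists_forall_lt (countable_singleton j)
      exact mem_iUnion.2 ⟨i, subset_closure (mem_image_of_mem a (hi j rfl))⟩
    · refine tendsto_nhds_unique (((Θ x).continuous.tendsto _).comp hlim)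
        (tendsto_const_nhds.congr' ?_)
      filter_upwards [hV i] with j hij
      exact (haT j x (hT hij hx)).symm
  · obtain ⟨i, hi⟩ := mem_iUnion.1 hq
    exact ⟨i, haz i q hi⟩

theorem HasAnnihilatingFamily.of_points (hΘ : ∀ x, ‖Θ x‖ ≤ ‖x‖)
    (hsep : ∀ p q : K, (∀ x, Θ x p = Θ x q) → p = q) {p : K} (a : OmegaOne → K)
    (hne : ∀ i, a i ≠ p) (ha : ∀ x, ∃ i, Θ x (a i) = Θ x p) : HasAnnihilatingFamily X := by
  let δ : K → StrongDual ℝ X := fun q =>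
    LinearMap.mkContinuous
      { toFun := fun x => Θ x q
        map_add' := fun x y => by simp
        map_smul' := fun c x => by simp } 1 fun x => by
      rw [one_mul]
      exact ((Θ x).norm_coe_le_norm q).trans (hΘ x)
  have hδ : ∀ q x, δ q x = Θ x q := fun _ _ => rfl
  refine ⟨fun i => δ (a i) - δ p, fun i h => hne i (hsep _ _ fun x => ?_), fun x => ?_⟩
  · simpa [hδ, sub_eq_zero] using DFunLike.congr_fun h x
  · obtain ⟨i, hi⟩ := ha x
    exact ⟨i, by simp [hδ, hi]⟩

theorem OmegaClosed.hasAnnihilatingFamily (hΘ : ∀ x, ‖Θ x‖ ≤ ‖x‖)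
    (hind : IsInducing fun (p : K) (x : X) => Θ x p)
    (hsep : ∀ p q : K, (∀ x, Θ x p = Θ x q) → p = q)
    (hA : OmegaClosed A) {z : K} (hz : z ∈ closure A) (hzA : z ∉ A) :
    HasAnnihilatingFamily X := by
  obtain ⟨D, T, hD, hTc, hT, ⟨q₀, hq₀, hq₀T⟩, hDT⟩ := hA.exists_omegaOne_generated hsep hz hzA
  let P : Set K := {q | q ∈ closure D ∧ ∀ i, ∀ x ∈ T i, Θ x q = Θ x z}
  have hPc : IsClosed P := by
    have e : P = closure D ∩ ⋂ i, ⋂ x ∈ T i, {q | Θ x q = Θ x z} := by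
      ext q
      simp [P]
    rw [e]
    exact isClosed_closure.inter (isClosed_iInter fun i => isClosed_biInter fun x _ =>
      isClosed_eq (by fun_prop) continuous_const)
  have : CompactSpace P := isCompact_iff_compactSpace.1 hPc.isCompact
  have : Nonempty P := ⟨⟨q₀, hq₀, hq₀T⟩⟩
  let ΘP : X →ₗ[ℝ] C(P, ℝ) :=
    { toFun := fun x => (Θ x).restrict P
      map_add' := fun x y => by ext; simp
      map_smul' := fun c x => by ext; simp }
  have hΘP : ∀ x (q : P), ΘP x q = Θ x q := fun _ _ => rfl
  rcases hasAnnihilatingFamily_or_exists_fiber_subset (Θ := ΘP)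
    (fun x => ((ContinuousMap.norm_le _ (norm_nonneg x)).2 fun q =>
      ((Θ x).norm_coe_le_norm q).trans (hΘ x)))
    (hind.comp IsInducing.subtypeVal) with h | ⟨E, hE, p, hp⟩
  · exact h
  -- A sequence meeting every basic family of joint fibers.
  have := hE.to_subtype
  let π : P → E → ℝ := fun r x => Θ x r
  have hπ : Continuous π := by fun_prop
  obtain ⟨y, hy⟩ := TopologicalSpace.exists_dense_seq (range π)
  choose c hc using fun n => (y n).2
  let fib : ℕ → Set P := fun n => {r | ∀ x ∈ E, Θ x r = Θ x (c n)}
  have hfib : ∀ U ∈ 𝓝 p, ∃ n, fib n ⊆ U := by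
    intro U hU
    obtain ⟨V, hVU, hVo, hpV⟩ := mem_nhds_iff.1 hU
    obtain ⟨q, hq⟩ := hp V (hVo.mem_nhds hpV)
    -- The values whose fiber lies in V form a relatively open set, the complement of the compact
    -- image of Vᶜ, so the dense sequence meets it.
    have hcl : IsClosed (π '' Vᶜ) := (hVo.isClosed_compl.isCompact.image hπ).isClosed
    have hqV : π q ∈ (π '' Vᶜ)ᶜ := by
      rintro ⟨r, hr, hrq⟩
      exact hr (hq fun x hx => congrFun hrq ⟨x, hx⟩)
    obtain ⟨_, hmem, n, rfl⟩ := hy.inter_open_nonempty _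
      (hcl.isOpen_compl.preimage continuous_subtype_val) ⟨⟨π q, mem_range_self q⟩, hqV⟩
    refine ⟨n, fun r hr => hVU ?_⟩
    by_contra hrV
    refine hmem ⟨r, hrV, ?_⟩
    rw [← hc n]
    funext x
    exact hr x x.2
  -- Along an ultrafilter refining `𝓕`, the fibers shrink to `p`.
  let 𝓕 : Filter ℕ := (𝓝 p).lift' fun U => {n | fib n ⊆ U}
  have hmono : Monotone fun U : Set P => {n | fib n ⊆ U} := fun U V hUV n hn =>
    Subset.trans (show fib n ⊆ U from hn) hUV
  have h𝓕 : 𝓕.NeBot := (lift'_neBot_iff hmono).2 hfib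
  let 𝓤 : Ultrafilter ℕ := Ultrafilter.of 𝓕
  have h𝓤 : ∀ U ∈ 𝓝 p, ∀ᶠ n in (𝓤 : Filter ℕ), fib n ⊆ U := fun U hU =>
    Ultrafilter.of_le _ (mem_lift' hU)
  -- Approximate each chosen point by points of `D`.
  choose b hbD hb using fun (n : ℕ) (i : OmegaOne) =>
    hD.exists_eq_on (Θ := Θ) (c n).2.1 (hE.union (hTc i))
  let a : OmegaOne → K := fun i => (𝓤.map fun n => b n i).lim
  have hlim : ∀ i, Tendsto (fun n => b n i) 𝓤 (𝓝 (a i)) := fun i =>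
    (𝓤.map fun n => b n i).le_nhds_lim
  have haD : ∀ i, a i ∈ D := fun i =>
    hD (range fun n => b n i) (range_subset_iff.2 fun n => hbD n i) (countable_range _)
      (mem_closure_of_tendsto (hlim i) (Eventually.of_forall fun n => mem_range_self n))
  refine .of_points hΘ hsep (p := p) a (fun i hi => ?_) fun x => ?_
  · obtain ⟨j, x, hx, hne⟩ := hDT p (hi ▸ haD i)
    exact hne (p.2.2 j x hx)
  -- If a joint fiber lies in an open set, then so do almost all of the approximating points.
  have hev : ∀ (V : Set K), IsOpen V → ∀ n, fib n ⊆ (↑) ⁻¹' V → ∃ i, ∀ j, i ≤ j → b n j ∈ V := by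
    intro V hV n hn
    by_contra! hcon
    -- A limit of the offending points as j grows agrees with z on all `T i`, so it lies in `P` and
    -- in the fiber, hence in V; but points outside the open set V cannot converge into V.
    have hfr : ∃ᶠ j in atTop, b n j ∉ V := frequently_atTop.2 hcon
    have hne : (atTop ⊓ 𝓟 {j | b n j ∉ V}).NeBot := frequently_mem_iff_neBot.1 hfr
    let 𝓥 : Ultrafilter OmegaOne := Ultrafilter.of (atTop ⊓ 𝓟 {j | b n j ∉ V})
    have hV1 : ∀ i, ∀ᶠ j in (𝓥 : Filter OmegaOne), i ≤ j := fun i =>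
      Ultrafilter.of_le _ (mem_inf_of_left (mem_atTop i))
    have hV2 : ∀ᶠ j in (𝓥 : Filter OmegaOne), b n j ∉ V :=
      Ultrafilter.of_le _ (mem_inf_of_right (mem_principal_self _))
    let r := (𝓥.map (b n)).lim
    have hr : Tendsto (b n) 𝓥 (𝓝 r) := (𝓥.map (b n)).le_nhds_lim
    have hrT : ∀ i, ∀ x ∈ E ∪ T i, Θ x r = Θ x (c n) := fun i x hx => by
      refine tendsto_nhds_unique (((Θ x).continuous.tendsto _).comp hr)
        (tendsto_const_nhds.congr' ?_)
      filter_upwards [hV1 i] with j hij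
      exact (hb n j x (hx.imp id fun h => hT hij h)).symm
    have hrP : r ∈ P := ⟨mem_closure_of_tendsto hr (Eventually.of_forall fun j => hbD n j),
      fun i x hx => (hrT i x (.inr hx)).trans ((c n).2.2 i x hx)⟩
    have hrV : r ∈ V := hn (show (⟨r, hrP⟩ : P) ∈ fib n from
      fun x hx => hrT (Classical.arbitrary _) x (.inl hx))
    obtain ⟨j, hj1, hj2⟩ := (hV2.and (hr.eventually (hV.mem_nhds hrV))).exists
    exact hj1 hj2
  let V : ℕ → Set K := fun k => {q | |Θ x q - Θ x p| < 1 / ((k : ℝ) + 1)}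
  have hVo : ∀ k, IsOpen (V k) := fun k => isOpen_lt (by fun_prop) continuous_const
  have hVp : ∀ k, ((↑) ⁻¹' V k : Set P) ∈ 𝓝 p := fun k =>
    ((hVo k).preimage continuous_subtype_val).mem_nhds (by
      change |Θ x p - Θ x p| < _
      rw [sub_self, abs_zero]
      positivity)
  choose! i hi using fun (k n : ℕ) (hkn : fib n ⊆ (↑) ⁻¹' V k) => hev (V k) (hVo k) n hkn
  -- Only countably many thresholds occur, one for each tolerance and fiber, so some j exceeds them
  -- all.
  obtain ⟨j, hj⟩ := OmegaOne.exists_forall_lt_range fun k : ℕ × ℕ => i k.1 k.2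
  refine ⟨j, ?_⟩
  have hle : ∀ k : ℕ, |Θ x (a j) - Θ x p| ≤ 1 / ((k : ℝ) + 1) := fun k => by
    have ht : Tendsto (fun n => |Θ x (b n j) - Θ x p|) 𝓤 (𝓝 |Θ x (a j) - Θ x p|) :=
      ((((Θ x).continuous.tendsto _).comp (hlim j)).sub_const _).abs
    refine le_of_tendsto ht ?_
    filter_upwards [h𝓤 _ (hVp k)] with n hn
    exact (show b n j ∈ V k from hi k n hn j (hj (k, n)).le).le
  have h0 : |Θ x (a j) - Θ x p| ≤ 0 :=
    ge_of_tendsto tendsto_one_div_add_atTop_nhds_zero_nat (Eventually.of_forall hle)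
  exact sub_eq_zero.1 (abs_nonpos_iff.1 h0)

end

/-! ### Tightness of the dual ball -/

section DualBall

variable {X : Type u} [NormedAddCommGroup X] [NormedSpace ℝ X]

theorem omegaClosed_iUnion_closure {K : Type*} [TopologicalSpace K] (A : Set K) :
    OmegaClosed {x | ∃ B ⊆ A, B.Countable ∧ x ∈ closure B} := by
  intro C hCA hC
  choose! B hBA hB hxB using fun c (hc : c ∈ C) => hCA hc
  have h : closure C ⊆ closure (⋃ c ∈ C, B c) := by
    refine closure_minimal (fun c hc => ?_) isClosed_closure
    exact closure_mono (subset_biUnion_of_mem (u := B) hc) (hxB c hc)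
  exact fun x hx => ⟨_, iUnion₂_subset hBA, hC.biUnion hB, h hx⟩

instance compactSpace_weakStarDualBall : CompactSpace (weakStarDualBall X) := by
  rw [← isCompact_iff_compactSpace]
  have e : weakStarDualBall X = WeakDual.toStrongDual ⁻¹' Metric.closedBall 0 1 := by
    ext f
    simp [weakStarDualBall]
  rw [e]
  exact WeakDual.isCompact_closedBall 0 1

/-- Evaluation of functionals of the dual ball. -/
noncomputable def dualBallEval : X →ₗ[ℝ] C(weakStarDualBall X, ℝ) where
  toFun x := ⟨fun f => f.1 x, (WeakDual.eval_continuous x).comp continuous_subtype_val⟩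
  map_add' x y := by ext f; exact map_add f.1 x y
  map_smul' c x := by ext f; exact map_smul f.1 c x

theorem HasAnnihilatingFamily.of_not_countablyTight
    (h : ¬ IsCountablyTight (weakStarDualBall X)) : HasAnnihilatingFamily X := by
  simp only [IsCountablyTight, not_forall] at h
  obtain ⟨A, z, hz, hzA⟩ := h
  refine OmegaClosed.hasAnnihilatingFamily (Θ := dualBallEval) (fun x => ?_) ?_ ?_
    (omegaClosed_iUnion_closure A) (z := z) (closure_mono (fun a ha => ?_) hz) hzA
  · refine (ContinuousMap.norm_le _ (norm_nonneg x)).2 fun f => ?_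
    have := (WeakDual.toStrongDual f.1).le_of_opNorm_le f.2 x
    rwa [one_mul] at this
  · have h1 : IsInducing fun (f : WeakDual ℝ X) (x : X) => f x := ⟨rfl⟩
    exact h1.comp IsInducing.subtypeVal
  · exact fun f g hfg => Subtype.ext (DFunLike.ext _ _ hfg)
  · exact ⟨{a}, singleton_subset_iff.2 ha, countable_singleton a, subset_closure rfl⟩

/-- Extend scaled indicators of countable subsets of ω₁ to functionals on X. A limit along initial
segments is nonzero at every unit vector, but any countable set of these functionals vanishes at a
common one. -/
theorem ContainsEllOneOmegaOne.not_countablyTight (h : ContainsEllOneOmegaOne X) :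
    ¬ IsCountablyTight (weakStarDualBall X) := by
  obtain ⟨Y, ⟨T⟩⟩ := h
  let Z := lp (fun _ : OmegaOne => ℝ) 1
  let S : Y →L[ℝ] Z := T.symm
  -- Scaling by 1/M puts the extensions in the unit ball; the summand 1 ensures M > 0.
  let M := ‖S‖ + 1
  have hM : 0 < M := by positivity
  have hM' : ‖S‖ ≤ M := by simp [M]
  let e : OmegaOne → X := fun i => T (lp.single 1 i (1 : ℝ))
  classical
  have hext : ∀ C : Set OmegaOne, ∃ f : weakStarDualBall X, ∀ i,
      f.1 (e i) = if i ∈ C then 1 / M else 0 := by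
    intro C
    let B : OmegaOne → ℝ →L[ℝ] ℝ := fun i => if i ∈ C then .id ℝ ℝ else 0
    have hB : ∀ i, ‖B i‖ ≤ 1 := fun i => by
      by_cases hi : i ∈ C <;> simp [B, hi]
    let σ : StrongDual ℝ Z := lp.tsumCLM ℝ OmegaOne ℝ ∘L lp.mapCLM 1 B zero_le_one hB
    have hσ : ‖σ‖ ≤ 1 := by
      refine (ContinuousLinearMap.opNorm_comp_le _ _).trans ?_
      exact mul_le_one₀ lp.norm_tsumCLM_le (norm_nonneg _) (lp.norm_mapCLM_le 1 B zero_le_one hB)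
    have hσe : ∀ i, σ (lp.single 1 i (1 : ℝ)) = if i ∈ C then 1 else 0 := fun i => by
      change ∑' j, B j ((lp.single 1 i (1 : ℝ) : Z) j) = _
      rw [tsum_eq_single i fun j hj => by simp [lp.single_apply, hj]]
      by_cases hi : i ∈ C <;> simp [B, hi]
    obtain ⟨g, hg, hgn⟩ := exists_extension_norm_eq Y (M⁻¹ • σ ∘L S)
    refine ⟨⟨StrongDual.toWeakDual g, ?_⟩, fun i => ?_⟩
    · change ‖g‖ ≤ 1
      rw [hgn]
      refine (ContinuousLinearMap.opNorm_smul_le _ _).trans ?_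
      rw [norm_inv, Real.norm_of_nonneg hM.le, inv_mul_le_iff₀ hM, mul_one]
      refine (ContinuousLinearMap.opNorm_comp_le _ _).trans ?_
      exact (mul_le_of_le_one_left (norm_nonneg S) hσ).trans hM'
    · change g (e i) = _
      rw [hg]
      change M⁻¹ * σ (T.symm (T (lp.single 1 i (1 : ℝ)))) = _
      rw [T.symm_apply_apply, hσe]
      by_cases hi : i ∈ C <;> simp [hi]
  choose f hf using hext
  intro ht
  let 𝓥 : Ultrafilter OmegaOne := Ultrafilter.of atTop
  have hV : ∀ i, ∀ᶠ j in (𝓥 : Filter OmegaOne), i < j := fun i =>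
    Ultrafilter.of_le _ (by
      obtain ⟨k, hk⟩ := OmegaOne.exists_forall_lt (countable_singleton i)
      exact (eventually_ge_atTop k).mono fun j hj => (hk i rfl).trans_le hj)
  let z := (𝓥.map fun i => f (Iio i)).lim
  have hz : Tendsto (fun i => f (Iio i)) 𝓥 (𝓝 z) := (𝓥.map fun i => f (Iio i)).le_nhds_lim
  have hze : ∀ i, z.1 (e i) = 1 / M := fun i => by
    refine tendsto_nhds_unique (((dualBallEval (e i)).continuous.tendsto _).comp hz)
      (tendsto_const_nhds.congr' ?_)
    filter_upwards [hV i] with j hij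
    exact ((hf (Iio j) i).trans (if_pos hij)).symm
  obtain ⟨B, hBA, hB, hzB⟩ := ht (f '' {C | C.Countable}) z
    (mem_closure_of_tendsto hz (Eventually.of_forall fun i =>
      mem_image_of_mem f (countable_Iio_omegaOne i)))
  choose! C hC hCB using fun g (hg : g ∈ B) => hBA hg
  obtain ⟨i, hi⟩ := OmegaOne.exists_forall_lt (hB.biUnion hC)
  have hcl : closure B ⊆ {g | dualBallEval (e i) g = 0} := by
    refine closure_minimal (fun g hg => ?_) (isClosed_eq (by fun_prop) continuous_const)
    rw [← hCB g hg]
    exact (hf (C g) i).trans (if_neg fun h => lt_irrefl i (hi i (mem_biUnion hg h)))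
  have h0 : z.1 (e i) = 0 := hcl hzB
  rw [hze] at h0
  exact (one_div_pos.2 hM).ne' h0

end DualBall

theorem theorem1p5 (X : Type u) [NormedAddCommGroup X] [NormedSpace ℝ X] [CompleteSpace X]
    (hX : ¬ TopologicalSpace.SeparableSpace X)
    (h : HasFundamentalBiorthogonalSystem X ∨
      IsSpaceOfContinuousOnScattered.{u, v} X ∨
      ContainsEllOneOmegaOne X ∨
      ¬ IsCountablyTight (weakStarDualBall X)) :
    (∃ F : Set (Submodule ℝ X), (∀ H ∈ F, IsHyperplane H) ∧ #F = ℵ₁ ∧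
      ⋃ H ∈ F, (H : Set X) = Set.univ) ∧
    covNumber X = ℵ₁ := by
  refine HasAnnihilatingFamily.covering ?_
  rcases h with h | h | h | h
  · exact .of_fundamentalBiorthogonalSystem hX h
  · exact .of_continuousOnScattered hX h
  · exact .of_not_countablyTight h.not_countablyTight
  · exact .of_not_countablyTight h
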